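/- Let $S$ be a finite set of positive integers. A permutation of $S$ is a word in which each element of $S$ occurs exactly once and no other letter occurs. For a letter $x$ of a permutation $\pi$, let $\rho_\pi(x)$ be the maximal consecutive subword of $\pi$ consisting of letters immediately to the right of $x$ which are all larger than $x$; $\pi$ is called Jacobi if $\rho_\pi(x)$ has even length for every letter $x$ of $\pi$. Let $\mathfrak{J}_n$ be the set of Jacobi permutations of $\{1,\dots,n\}$, where $\mathfrak{J}_0$ consists of the empty word. For $\pi=\pi_1\cdots\pi_n$, let $\operatorname{lrmin}(\pi)$ be the number of left-to-right minima of $\pi$, that is, of indices $k$ such that $\pi_k<\pi_i$ for all $i<k$. Theorem. As formal power series in $x$ with coefficients in $\mathbb{Q}[t]$, $$\sum_{n=0}^{\infty}\ \sum_{\pi\in\mathfrak{J}_n} t^{\operatorname{lrmin}(\pi)}\,\frac{x^n}{n!}=(\sec x+\tan x)^t .$$ Here $f^t=\exp(t\log f)$ for a power series $f$ with constant term $1$. -/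

import Mathlib

namespace JacobiPerm

/-- The permutations of a finite set `S`, written as words: the lists in which each element of `S`
occurs exactly once and nothing else occurs. -/
def perms (S : Finset ℕ) : Finset (List ℕ) := S.val.lists.toFinset

theorem mem_perms {S : Finset ℕ} {π : List ℕ} : π ∈ perms S ↔ π.Nodup ∧ π.toFinset = S := by
  simp only [perms, Multiset.mem_toFinset, Multiset.mem_lists_iff]
  constructor
  · intro h
    have h' : S.val = (π : Multiset ℕ) := h
    have hn : π.Nodup := by rw [← Multiset.coe_nodup, ← h']; exact S.nodup
    refine ⟨hn, ?_⟩
    ext a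
    simp [← Finset.mem_val, h']
  · rintro ⟨h, rfl⟩
    simp [h.dedup]

/-- For a letter `x` of the word `π`, the maximal consecutive subword of `π` consisting of letters
immediately to the right of `x` which are all larger than `x`. (`π.dropWhile (· ≠ x)` is the suffix
of `π` that starts with `x`; its tail consists of the letters to the right of `x`.) -/
def rho (π : List ℕ) (x : ℕ) : List ℕ :=
  (π.dropWhile (fun z => decide (z ≠ x))).tail.takeWhile (fun z => decide (x < z))

/-- A permutation `π`, as a word, is Jacobi if `rho π x` has even length for each letter `x`. -/
def IsJacobi (π : List ℕ) : Prop := ∀ x ∈ π, Even (rho π x).length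

instance (π : List ℕ) : Decidable (IsJacobi π) :=
  inferInstanceAs (Decidable (∀ x ∈ π, Even (rho π x).length))

/-- The number of left-to-right minima of `π`: the number of positions `k` such that
`π k < π i` for all `i < k`. -/
def lrmin (π : List ℕ) : ℕ :=
  (Finset.univ.filter fun k : Fin π.length =>
    ∀ i : Fin π.length, i < k → π.get k < π.get i).card

/-- The set of Jacobi permutations of `[n] = {1, …, n}`. -/
def jacobi (n : ℕ) : Finset (List ℕ) := (perms (Finset.Icc 1 n)).filter IsJacobi

/-- `J(t, x) = ∑ n, ∑ π ∈ jacobi n, t ^ lrmin π * x ^ n / n!`, as a formal power series in `x`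
whose coefficients are polynomials in `t`. -/
noncomputable def lrminGenFun : PowerSeries (Polynomial ℚ) :=
  PowerSeries.mk fun n =>
    Polynomial.C (1 / (n.factorial : ℚ)) * ∑ π ∈ jacobi n, Polynomial.X ^ lrmin π

/-- The formal power series of `sec x`. -/
noncomputable def sec : PowerSeries ℚ := (PowerSeries.cos ℚ)⁻¹

/-- The formal power series of `tan x`. -/
noncomputable def tan : PowerSeries ℚ := PowerSeries.sin ℚ * (PowerSeries.cos ℚ)⁻¹

/-- The power `f ^ r = exp (r * log f)` of a formal power series `f` with constant term `1`, where
the exponent `r` is an element of the coefficient ring. -/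
noncomputable def formalPow {A : Type*} [CommRing A] [Algebra ℚ A]
    (f : PowerSeries A) (r : A) : PowerSeries A :=
  (PowerSeries.exp A).subst (PowerSeries.C r * PowerSeries.logOf f)

end JacobiPerm

/-!
A word with minimum `m` factors uniquely as `α m β`. The run of larger letters following `m` is all
of `β`, while runs that start in `α` stop at `m` at the latest; so the word is Jacobi if and only if
`α` and `β` are Jacobi and `β` has even length (`isJacobi_append_iff`). Its left-to-right minima are
those of `α`, and `m` (`lrmin_append`). Hence the sum of `t ^ lrmin π` over the Jacobi permutations
of a set satisfies a recurrence over subsets (`lrminSum_eq_sum_powerset`), which also shows that the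
sum depends only on the cardinality of the set (`lrminSum_eq_lrminSum_Icc`).

For the exponential generating function `J_t` (`lrminEGF`) the recurrence says `J_t' = t J_t E`,
where `E` (`evenEGF`) counts the Jacobi permutations of even length. At `t = 1`, with `J_1 = E + O`
split into its even and odd parts, this becomes the system `E' = O E`, `O' = E²`. The pair
`(sec, tan)` solves it with the same constant terms, so `E = sec` (`evenEGF_eq_map_sec`). Since
`(log (sec + tan))' = sec`, the series `J_t` and `(sec + tan) ^ t` both solve `F' = t F sec` with
constant term `1`, and therefore agree (`eq_of_derivative_eq_mul`).
-/

namespace JacobiPerm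

open PowerSeries

/-! ### Splitting a word at its minimum -/

/-- A smaller letter `m` to the right of `α` stops every run of letters larger than `x ∈ α`. -/
theorem rho_append_of_mem {α β : List ℕ} {m x : ℕ} (hx : x ∈ α) (hm : m < x) :
    rho (α ++ m :: β) x = rho α x := by
  have hd : α.dropWhile (fun z => decide (z ≠ x)) ≠ [] := by
    intro h
    simpa using List.dropWhile_eq_nil_iff.1 h x hx
  obtain ⟨y, l, hl⟩ := List.exists_cons_of_ne_nil hd
  have hmx : ¬ x < m := by omega
  simp only [rho, List.dropWhile_append, hl]
  simp only [List.isEmpty_cons, Bool.false_eq_true, if_false, List.cons_append, List.tail_cons,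
    List.takeWhile_append, List.takeWhile_cons, hmx, decide_false, List.append_nil]
  split_ifs with h
  · exact ((List.takeWhile_prefix _).eq_of_length h).symm
  · rfl

theorem rho_append_of_notMem {α β : List ℕ} {m x : ℕ} (hx : x ∉ α) (hm : m ≠ x) :
    rho (α ++ m :: β) x = rho β x := by
  have h : ∀ z ∈ α, decide (z ≠ x) = true := by
    intro z hz
    simpa using fun h : z = x => hx (h ▸ hz)
  rw [rho, List.dropWhile_append_of_pos h, List.dropWhile_cons_of_pos (by simpa using hm), rho]

theorem rho_append_self {α β : List ℕ} {m : ℕ} (hα : m ∉ α) (hβ : ∀ z ∈ β, m < z) :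
    rho (α ++ m :: β) m = β := by
  have h : ∀ z ∈ α, decide (z ≠ m) = true := by
    intro z hz
    simpa using fun h : z = m => hα (h ▸ hz)
  rw [rho, List.dropWhile_append_of_pos h, List.dropWhile_cons_of_neg (by simp), List.tail_cons]
  simpa using hβ

/-- Splitting a word at its minimum `m`: the run at `m` is all of `β`, whence the parity condition,
and the runs at the other letters are those in `α` and in `β`. -/
theorem isJacobi_append_iff {α β : List ℕ} {m : ℕ} (hα : ∀ z ∈ α, m < z)
    (hβ : ∀ z ∈ β, m < z) (hd : α.Disjoint β) :
    IsJacobi (α ++ m :: β) ↔ IsJacobi α ∧ IsJacobi β ∧ Even β.length := by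
  have hm : m ∉ α := fun h => (hα m h).false
  have h1 : ∀ x ∈ α, rho (α ++ m :: β) x = rho α x := fun x hx => rho_append_of_mem hx (hα x hx)
  have h2 : ∀ x ∈ β, rho (α ++ m :: β) x = rho β x := fun x hx =>
    rho_append_of_notMem (fun h => hd h hx) (hβ x hx).ne
  simp only [IsJacobi, List.forall_mem_append, List.forall_mem_cons, rho_append_self hm hβ]
  refine and_congr (forall₂_congr fun x hx => by rw [h1 x hx]) ?_
  rw [and_comm]
  exact and_congr_left' (forall₂_congr fun x hx => by rw [h2 x hx])

/-- `lrmin` as a sum over natural numbers, which splits along a concatenation. The default value `0`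
of `getD` is never read, as all indices are in range. -/
theorem lrmin_eq_sum (π : List ℕ) :
    lrmin π = ∑ k ∈ Finset.range π.length,
      if ∀ i < k, π.getD k 0 < π.getD i 0 then 1 else 0 := by
  rw [lrmin, Finset.card_filter, ← Fin.sum_univ_eq_sum_range
    (fun k => if ∀ i < k, π.getD k 0 < π.getD i 0 then 1 else 0)]
  refine Finset.sum_congr rfl fun k _ => if_congr ?_ rfl rfl
  constructor
  · intro h i hi
    have := h ⟨i, hi.trans k.2⟩ hi
    rw [List.getD_eq_getElem _ _ k.2, List.getD_eq_getElem _ _ (hi.trans k.2)]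
    simpa using this
  · intro h i hi
    have := h i hi
    rw [List.getD_eq_getElem _ _ k.2, List.getD_eq_getElem _ _ i.2] at this
    simpa using this

/-- The minimum `m` is a left-to-right minimum, and no letter to its right is one. -/
theorem lrmin_append {α β : List ℕ} {m : ℕ} (hα : ∀ z ∈ α, m < z) (hβ : ∀ z ∈ β, m < z) :
    lrmin (α ++ m :: β) = lrmin α + 1 := by
  have hm : (α ++ m :: β).getD α.length 0 = m := by
    simp
  have hl : ∀ i < α.length, (α ++ m :: β).getD i 0 = α.getD i 0 := fun i hi =>
    List.getD_append _ _ _ _ hi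
  rw [lrmin_eq_sum, lrmin_eq_sum, List.length_append, List.length_cons,
    Finset.sum_range_add, Finset.sum_range_succ', add_zero]
  have h0 : ∑ k ∈ Finset.range β.length, (if ∀ i < α.length + (k + 1),
      (α ++ m :: β).getD (α.length + (k + 1)) 0 < (α ++ m :: β).getD i 0 then 1 else 0) = 0 := by
    refine Finset.sum_eq_zero fun k hk => if_neg fun h => ?_
    have hk := Finset.mem_range.1 hk
    have := h α.length (by omega)
    rw [hm, List.getD_append_right _ _ _ _ (by omega)] at this
    simp only [Nat.add_sub_cancel_left, List.getD_cons_succ, List.getD_eq_getElem _ _ hk] at this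
    exact (this.trans (hβ _ (List.getElem_mem hk))).false
  rw [h0, zero_add, if_pos]
  · congr 1
    refine Finset.sum_congr rfl fun k hk => if_congr ?_ rfl rfl
    have hk := Finset.mem_range.1 hk
    refine forall₂_congr fun i hi => ?_
    rw [hl k hk, hl i (hi.trans hk)]
  · intro i hi
    rw [hm, hl i hi, List.getD_eq_getElem _ _ hi]
    exact hα _ (List.getElem_mem hi)

/-! ### The recurrence for the weighted count -/

/-- The sum of `t ^ lrmin π` over the Jacobi permutations `π` of a finite set `S`. -/
def lrminSum {R : Type*} [CommSemiring R] (t : R) (S : Finset ℕ) : R :=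
  ∑ π ∈ (perms S).filter IsJacobi, t ^ lrmin π

theorem lrminSum_empty {R : Type*} [CommSemiring R] (t : R) : lrminSum t ∅ = 1 := by
  have h : (perms ∅).filter IsJacobi = {[]} := by
    ext π
    simp only [Finset.mem_filter, mem_perms, List.toFinset_eq_empty_iff, Finset.mem_singleton]
    constructor
    · exact fun h => h.1.2
    · rintro rfl
      simp [IsJacobi]
  simp [lrminSum, h, lrmin]

/-- The recurrence from the factorization `π = α m β` at the minimum `m` of `S`, with `T` the set of
letters of `β`. The letters of `β` contribute no left-to-right minima, so the weight of `β`
is `1`. -/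
theorem lrminSum_eq_sum_powerset {R : Type*} [CommSemiring R] (t : R) {S : Finset ℕ} {m : ℕ}
    (hmS : m ∈ S) (hm : ∀ x ∈ S, m ≤ x) :
    lrminSum t S = ∑ T ∈ (S.erase m).powerset,
      if Even T.card then t * lrminSum t (S.erase m \ T) * lrminSum 1 T else 0 := by
  have hlt : ∀ x ∈ S.erase m, m < x := fun x hx =>
    lt_of_le_of_ne (hm x (Finset.mem_of_mem_erase hx)) (Finset.ne_of_mem_erase hx).symm
  -- The hypotheses of the factorization lemmas hold for every choice of `T`, `α` and `β`.
  have hsplit : ∀ T ∈ (S.erase m).powerset, ∀ α ∈ perms (S.erase m \ T), ∀ β ∈ perms T,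
      (∀ z ∈ α, m < z) ∧ (∀ z ∈ β, m < z) ∧ α.Disjoint β ∧ β.length = T.card := by
    intro T hT α hα β hβ
    rw [Finset.mem_powerset] at hT
    rw [mem_perms] at hα hβ
    have hα' : ∀ z, z ∈ α → z ∈ S.erase m \ T := fun z hz => by
      rw [← hα.2]; exact List.mem_toFinset.2 hz
    have hβ' : ∀ z, z ∈ β → z ∈ T := fun z hz => by
      rw [← hβ.2]; exact List.mem_toFinset.2 hz
    refine ⟨fun z hz => hlt z (Finset.mem_sdiff.1 (hα' z hz)).1, fun z hz => hlt z (hT (hβ' z hz)),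
      fun z hz hz' => (Finset.mem_sdiff.1 (hα' z hz)).2 (hβ' z hz'), ?_⟩
    rw [← hβ.2, List.toFinset_card_of_nodup hβ.1]
  have hterm : ∀ T ∈ (S.erase m).powerset,
      (if Even T.card then t * lrminSum t (S.erase m \ T) * lrminSum 1 T else 0) =
      ∑ p ∈ (perms (S.erase m \ T) ×ˢ perms T).filter (fun p => IsJacobi (p.1 ++ m :: p.2)),
        t ^ lrmin (p.1 ++ m :: p.2) := by
    intro T hT
    have hiff : ∀ p ∈ perms (S.erase m \ T) ×ˢ perms T, (IsJacobi (p.1 ++ m :: p.2) ↔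
        IsJacobi p.1 ∧ IsJacobi p.2 ∧ Even T.card) := by
      intro p hp
      rw [Finset.mem_product] at hp
      obtain ⟨h1, h2, h3, h4⟩ := hsplit T hT _ hp.1 _ hp.2
      rw [isJacobi_append_iff h1 h2 h3, h4]
    rw [Finset.filter_congr hiff]
    split_ifs with he
    · simp only [he, and_true]
      rw [Finset.filter_product, Finset.sum_product, lrminSum, lrminSum]
      simp only [one_pow]
      rw [mul_assoc, Finset.sum_mul_sum, Finset.mul_sum]
      refine Finset.sum_congr rfl fun α hα => ?_
      rw [Finset.mul_sum]
      refine Finset.sum_congr rfl fun β hβ => ?_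
      obtain ⟨h1, h2, -, -⟩ := hsplit T hT _ (Finset.mem_filter.1 hα).1 _ (Finset.mem_filter.1 hβ).1
      rw [lrmin_append h1 h2, pow_succ', mul_one]
    · simp [he]
  rw [Finset.sum_congr rfl hterm, Finset.sum_sigma', lrminSum]
  symm
  refine Finset.sum_bij (fun q _ => q.2.1 ++ m :: q.2.2) ?_ ?_ ?_ ?_
  · rintro ⟨T, α, β⟩ hq
    simp only [Finset.mem_sigma, Finset.mem_filter, Finset.mem_product] at hq
    obtain ⟨hT, ⟨hα, hβ⟩, hJ⟩ := hq
    obtain ⟨h1, h2, h3, -⟩ := hsplit T hT _ hα _ hβ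
    refine Finset.mem_filter.2 ⟨?_, hJ⟩
    rw [mem_perms] at hα hβ ⊢
    refine ⟨?_, ?_⟩
    · refine List.nodup_append'.2 ⟨hα.1, List.nodup_cons.2 ⟨fun h => (h2 m h).false, hβ.1⟩, ?_⟩
      rw [List.disjoint_cons_right]
      exact ⟨fun h => (h1 m h).false, h3⟩
    · rw [List.toFinset_append, List.toFinset_cons, hα.2, hβ.2, Finset.union_insert,
        Finset.sdiff_union_of_subset (Finset.mem_powerset.1 hT), Finset.insert_erase hmS]
  · rintro ⟨T, α, β⟩ hq ⟨T', α', β'⟩ hq' heq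
    simp only [Finset.mem_sigma, Finset.mem_filter, Finset.mem_product] at hq hq' heq
    obtain ⟨hT, ⟨hα, hβ⟩, hJ⟩ := hq
    obtain ⟨hT', ⟨hα', hβ'⟩, hJ'⟩ := hq'
    obtain ⟨h1, -, -, -⟩ := hsplit T hT _ hα _ hβ
    obtain ⟨h1', -, -, -⟩ := hsplit T' hT' _ hα' _ hβ'
    -- The prefix is determined by the word: it is the part before the first letter `m`.
    have key : ∀ {γ δ : List ℕ}, (∀ z ∈ γ, m < z) →
        (γ ++ m :: δ).takeWhile (fun z => decide (m < z)) = γ := by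
      intro γ δ h
      rw [List.takeWhile_append_of_pos (by simpa using h)]
      simp
    have hαα : α = α' := by rw [← key (δ := β) h1, heq, key h1']
    subst hαα
    obtain rfl : β = β' := by simpa using heq
    obtain rfl : T = T' := by rw [← (mem_perms.1 hβ).2, (mem_perms.1 hβ').2]
    rfl
  · intro π hπ
    rw [Finset.mem_filter, mem_perms] at hπ
    obtain ⟨⟨hn, hS⟩, hJ⟩ := hπ
    have hmem : m ∈ π := by rw [← List.mem_toFinset, hS]; exact hmS
    obtain ⟨α, β, rfl⟩ := List.append_of_mem hmem
    obtain ⟨hα, hβ, hd⟩ := List.nodup_append'.1 hn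
    rw [List.nodup_cons] at hβ
    rw [List.disjoint_cons_right] at hd
    have hE : S.erase m = α.toFinset ∪ β.toFinset := by
      rw [← hS]
      ext x
      simp only [Finset.mem_erase, List.mem_toFinset, List.mem_append, List.mem_cons,
        Finset.mem_union]
      constructor
      · tauto
      · intro h
        refine ⟨?_, by tauto⟩
        rintro rfl
        tauto
    refine ⟨⟨β.toFinset, α, β⟩, ?_, rfl⟩
    simp only [Finset.mem_sigma, Finset.mem_filter, Finset.mem_product, Finset.mem_powerset,
      mem_perms]
    refine ⟨hE ▸ Finset.subset_union_right, ⟨⟨hα, ?_⟩, hβ.2, trivial⟩, hJ⟩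
    rw [hE, Finset.union_sdiff_right]
    refine (Finset.sdiff_eq_self_of_disjoint ?_).symm
    rw [Finset.disjoint_left]
    intro x hx hx'
    exact hd.2 (List.mem_toFinset.1 hx) (List.mem_toFinset.1 hx')
  · intro q _
    rfl

/-- The powerset recurrence with its terms grouped by the cardinality `k` of `T`, if `lrminSum` is
known to depend only on the cardinality for sets with at most `n` elements. -/
theorem lrminSum_eq_sum_choose {R : Type*} [CommSemiring R] (t : R) {U : Finset ℕ} {n : ℕ}
    (hU : U.card = n + 1)
    (h : ∀ (r : R) (T : Finset ℕ), T.card ≤ n → lrminSum r T = lrminSum r (Finset.Icc 1 T.card)) :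
    lrminSum t U = ∑ k ∈ Finset.range (n + 1), n.choose k •
      (if Even k then t * lrminSum t (Finset.Icc 1 (n - k)) * lrminSum 1 (Finset.Icc 1 k)
        else 0) := by
  have hne : U.Nonempty := Finset.card_pos.1 (by omega)
  have hc : (U.erase (U.min' hne)).card = n := by
    rw [Finset.card_erase_of_mem (U.min'_mem hne), hU, Nat.add_sub_cancel]
  rw [lrminSum_eq_sum_powerset t (U.min'_mem hne) fun x hx => U.min'_le x hx]
  have hs := Finset.sum_powerset_apply_card (x := U.erase (U.min' hne)) (fun k => if Even k
    then t * lrminSum t (Finset.Icc 1 (n - k)) * lrminSum 1 (Finset.Icc 1 k) else 0)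
  rw [hc] at hs
  rw [← hs]
  refine Finset.sum_congr rfl fun T hT => ?_
  rw [Finset.mem_powerset] at hT
  have hTc := Finset.card_le_card hT
  have hd := Finset.card_sdiff_of_subset hT
  rw [hc] at hTc hd
  rw [h t _ (hd.trans_le (Nat.sub_le _ _)), h 1 T hTc, hd]

/-- The sum `lrminSum t S` depends only on the cardinality of `S`: the recurrence obtained by
removing the minimum preserves this property, so no relabelling of words is needed. -/
theorem lrminSum_eq_lrminSum_Icc {R : Type*} [CommSemiring R] (t : R) (S : Finset ℕ) :
    lrminSum t S = lrminSum t (Finset.Icc 1 S.card) := by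
  induction hn : S.card using Nat.strong_induction_on generalizing t S with
  | _ n ih =>
  rcases n with _ | n
  · rw [Finset.card_eq_zero.1 hn]
    rfl
  · have h : ∀ (r : R) (T : Finset ℕ), T.card ≤ n →
        lrminSum r T = lrminSum r (Finset.Icc 1 T.card) :=
      fun r T hT => ih T.card (by omega) r T rfl
    rw [lrminSum_eq_sum_choose t hn h, lrminSum_eq_sum_choose t (by simp) h]

theorem lrminSum_Icc_succ {R : Type*} [CommSemiring R] (t : R) (n : ℕ) :
    lrminSum t (Finset.Icc 1 (n + 1)) = ∑ k ∈ Finset.range (n + 1), n.choose k •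
      (if Even k then t * lrminSum t (Finset.Icc 1 (n - k)) * lrminSum 1 (Finset.Icc 1 k)
        else 0) :=
  lrminSum_eq_sum_choose t (by simp) fun r T _ => lrminSum_eq_lrminSum_Icc r T

/-! ### Derivatives of trigonometric power series -/

theorem derivative_sin : d⁄dX ℚ (PowerSeries.sin ℚ) = PowerSeries.cos ℚ := by
  ext n
  rw [coeff_derivative, PowerSeries.sin, PowerSeries.cos, coeff_mk, coeff_mk]
  have hf : (n.factorial : ℚ) ≠ 0 := by positivity
  have hn : (n + 1 : ℚ) ≠ 0 := by positivity
  rcases Nat.even_or_odd' n with ⟨k, rfl | rfl⟩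
  · have h1 : (2 * k + 1) / 2 = k := by omega
    simp [h1, Nat.factorial_succ]
    field_simp
  · simp [Nat.even_add_one]

theorem derivative_cos : d⁄dX ℚ (PowerSeries.cos ℚ) = -PowerSeries.sin ℚ := by
  ext n
  rw [coeff_derivative, map_neg, PowerSeries.sin, PowerSeries.cos, coeff_mk, coeff_mk]
  have hf : (n.factorial : ℚ) ≠ 0 := by positivity
  have hn : (n + 1 : ℚ) ≠ 0 := by positivity
  rcases Nat.even_or_odd' n with ⟨k, rfl | rfl⟩
  · simp
  · have h1 : (2 * k + 1) / 2 = k := by omega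
    have h2 : (2 * k + 1 + 1) / 2 = k + 1 := by omega
    simp [Nat.even_add_one, h1, h2, Nat.factorial_succ, pow_succ] at hn ⊢
    field_simp

theorem constantCoeff_sin : constantCoeff (PowerSeries.sin ℚ) = 0 := by
  simp [PowerSeries.sin, ← coeff_zero_eq_constantCoeff_apply]

theorem constantCoeff_cos : constantCoeff (PowerSeries.cos ℚ) = 1 := by
  simp [PowerSeries.cos, ← coeff_zero_eq_constantCoeff_apply]

theorem sin_sq_add_cos_sq : PowerSeries.sin ℚ ^ 2 + PowerSeries.cos ℚ ^ 2 = 1 := by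
  refine derivative.ext ?_ ?_
  · rw [map_add, derivative_pow, derivative_pow, derivative_sin, derivative_cos, derivative_one]
    push_cast
    ring
  · simp [constantCoeff_sin, constantCoeff_cos]

theorem derivative_sec : d⁄dX ℚ sec = tan * sec := by
  rw [sec, tan, derivative_inv', derivative_cos]
  ring

theorem derivative_tan : d⁄dX ℚ tan = sec * sec := by
  have h : PowerSeries.cos ℚ * (PowerSeries.cos ℚ)⁻¹ = 1 :=
    PowerSeries.mul_inv_cancel _ (by simp [constantCoeff_cos])
  rw [sec, tan, Derivation.leibniz, derivative_inv', derivative_cos, derivative_sin, smul_eq_mul,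
    smul_eq_mul]
  linear_combination (PowerSeries.cos ℚ)⁻¹ ^ 2 * sin_sq_add_cos_sq +
    (-(PowerSeries.cos ℚ * (PowerSeries.cos ℚ)⁻¹)) * h

theorem constantCoeff_sec : constantCoeff sec = 1 := by
  simp [sec, constantCoeff_cos]

theorem constantCoeff_tan : constantCoeff tan = 0 := by
  simp [tan, constantCoeff_sin]

theorem derivative_map {R S : Type*} [CommRing R] [CommRing S] (f : R →+* S) (g : R⟦X⟧) :
    d⁄dX S (map f g) = map f (d⁄dX R g) := by
  ext n
  simp [coeff_derivative]

/-! ### Uniqueness for differential equations of power series -/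

section ODE

variable {R : Type*} [CommRing R] [IsAddTorsionFree R]

theorem coeff_succ_eq_of_coeff_derivative_eq {f g : R⟦X⟧} {n : ℕ}
    (h : coeff n (d⁄dX R f) = coeff n (d⁄dX R g)) : coeff (n + 1) f = coeff (n + 1) g := by
  rw [coeff_derivative, coeff_derivative, ← Nat.cast_succ, mul_comm, mul_comm _ (Nat.cast _),
    ← nsmul_eq_mul, ← nsmul_eq_mul] at h
  exact nsmul_right_injective n.succ_ne_zero h

theorem eq_of_derivative_eq_mul {f g a : R⟦X⟧} (hf : d⁄dX R f = f * a) (hg : d⁄dX R g = g * a)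
    (h0 : constantCoeff f = constantCoeff g) : f = g := by
  ext n
  induction n using Nat.strong_induction_on with
  | _ n ih =>
  rcases n with _ | n
  · simpa using h0
  refine coeff_succ_eq_of_coeff_derivative_eq ?_
  rw [hf, hg, coeff_mul, coeff_mul]
  refine Finset.sum_congr rfl fun p hp => ?_
  have := Finset.HasAntidiagonal.mem_antidiagonal.1 hp
  rw [ih p.1 (by omega)]

/-- The differential system `e' = o e`, `o' = e²`, satisfied by `sec` and `tan`, has at most one
solution with given constant terms. -/
theorem eq_of_derivative_eq_mul_of_derivative_eq_mul_self {e o e' o' : R⟦X⟧}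
    (he : d⁄dX R e = o * e) (ho : d⁄dX R o = e * e)
    (he' : d⁄dX R e' = o' * e') (ho' : d⁄dX R o' = e' * e')
    (h0 : constantCoeff e = constantCoeff e') (h0' : constantCoeff o = constantCoeff o') :
    e = e' := by
  suffices h : ∀ n, coeff n e = coeff n e' ∧ coeff n o = coeff n o' from ext fun n => (h n).1
  intro n
  induction n using Nat.strong_induction_on with
  | _ n ih =>
  rcases n with _ | n
  · simpa using ⟨h0, h0'⟩
  constructor <;> refine coeff_succ_eq_of_coeff_derivative_eq ?_
  · rw [he, he', coeff_mul, coeff_mul]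
    refine Finset.sum_congr rfl fun p hp => ?_
    have := Finset.HasAntidiagonal.mem_antidiagonal.1 hp
    rw [(ih p.1 (by omega)).2, (ih p.2 (by omega)).1]
  · rw [ho, ho', coeff_mul, coeff_mul]
    refine Finset.sum_congr rfl fun p hp => ?_
    have := Finset.HasAntidiagonal.mem_antidiagonal.1 hp
    rw [(ih p.1 (by omega)).1, (ih p.2 (by omega)).1]

end ODE

/-! ### Formal powers -/

section FormalPow

variable {A : Type*} [CommRing A] [Algebra ℚ A]

theorem derivative_log_mul_one_add_X : d⁄dX A (PowerSeries.log A) * (1 + X) = 1 := by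
  rw [deriv_log]
  ext n
  rw [mul_add, mul_one, map_add]
  rcases n with _ | n
  · simp
  · simp [coeff_succ_mul_X, pow_succ, coeff_one]

/-- The logarithmic derivative, in a form free of division: `(log f)' f = f'`. -/
theorem derivative_logOf_mul {f : A⟦X⟧} (hf : constantCoeff f = 1) :
    d⁄dX A (logOf f) * f = d⁄dX A f := by
  have hs : HasSubst (f - 1) := HasSubst.of_constantCoeff_zero' (by simp [hf])
  have h := congrArg (PowerSeries.subst (f - 1)) (derivative_log_mul_one_add_X (A := A))
  rw [subst_mul hs, subst_add hs, subst_X hs, ← coe_substAlgHom hs, map_one, coe_substAlgHom hs,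
    add_sub_cancel] at h
  rw [logOf_eq, derivative_subst hs, map_sub, derivative_one, sub_zero]
  linear_combination d⁄dX A f * h

theorem hasSubst_C_mul_logOf {f : A⟦X⟧} (hf : constantCoeff f = 1) (r : A) :
    HasSubst (C r * logOf f) :=
  HasSubst.of_constantCoeff_zero' (by simp [constantCoeff_logOf hf])

theorem constantCoeff_formalPow {f : A⟦X⟧} (hf : constantCoeff f = 1) (r : A) :
    constantCoeff (formalPow f r) = 1 := by
  have hs := hasSubst_C_mul_logOf hf r
  -- The library lemma on the constant term of a substitution needs a series with constant term `0`.
  have h : constantCoeff ((exp A - 1).subst (C r * logOf f)) = 0 :=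
    constantCoeff_subst_eq_zero (by
      rw [← constantCoeff_eq]; simp [constantCoeff_logOf hf]) _ (by simp)
  rw [← coe_substAlgHom hs, map_sub, map_one, map_sub, map_one, coe_substAlgHom hs] at h
  exact sub_eq_zero.1 h

theorem derivative_formalPow {f : A⟦X⟧} (hf : constantCoeff f = 1) (r : A) :
    d⁄dX A (formalPow f r) = formalPow f r * (C r * d⁄dX A (logOf f)) := by
  rw [formalPow, derivative_subst (hasSubst_C_mul_logOf hf r), derivative_exp]
  simp [Derivation.leibniz]

end FormalPow

/-! ### Exponential generating functions -/

section EGF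

variable {A : Type*} [CommRing A] [Algebra ℚ A]

/-- The exponential generating function `∑ n, lrminSum t {1, …, n} * x ^ n / n!`. -/
noncomputable def lrminEGF (t : A) : A⟦X⟧ :=
  PowerSeries.mk fun n => algebraMap ℚ A (1 / (n.factorial : ℚ)) * lrminSum t (Finset.Icc 1 n)

variable (A) in
/-- The exponential generating function of the numbers of Jacobi permutations of `{1, …, n}` with
`n` even. -/
noncomputable def evenEGF : A⟦X⟧ :=
  PowerSeries.mk fun n => if Even n then coeff n (lrminEGF (1 : A)) else 0

variable (A) in
/-- The exponential generating function of the numbers of Jacobi permutations of `{1, …, n}` with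
`n` odd. -/
noncomputable def oddEGF : A⟦X⟧ :=
  PowerSeries.mk fun n => if Odd n then coeff n (lrminEGF (1 : A)) else 0

theorem constantCoeff_lrminEGF (t : A) : constantCoeff (lrminEGF t) = 1 := by
  simp [lrminEGF, ← coeff_zero_eq_constantCoeff_apply, lrminSum_empty]

/-- The recurrence for `lrminSum` in the language of generating functions. -/
theorem derivative_lrminEGF (t : A) :
    d⁄dX A (lrminEGF t) = lrminEGF t * (C t * evenEGF A) := by
  ext n
  rw [mul_comm, mul_assoc, coeff_C_mul, coeff_derivative, lrminEGF, coeff_mk, lrminSum_Icc_succ,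
    coeff_mul, Finset.Nat.sum_antidiagonal_eq_sum_range_succ_mk, Finset.mul_sum, Finset.mul_sum,
    Finset.sum_mul]
  refine Finset.sum_congr rfl fun k hk => ?_
  have hk : k ≤ n := Nat.lt_succ_iff.1 (Finset.mem_range.1 hk)
  simp only [evenEGF, coeff_mk, lrminEGF]
  split_ifs with he
  · have hc : algebraMap ℚ A (1 / ((n + 1).factorial : ℚ)) * (n.choose k : A) * ((n : A) + 1) =
        algebraMap ℚ A (1 / ((n - k).factorial : ℚ)) * algebraMap ℚ A (1 / (k.factorial : ℚ)) := by
      have hn : (n : A) + 1 = algebraMap ℚ A ((n : ℚ) + 1) := by simp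
      rw [hn, ← map_natCast (algebraMap ℚ A), ← map_mul, ← map_mul, ← map_mul,
        Nat.cast_choose ℚ hk, Nat.factorial_succ, Nat.cast_mul, Nat.cast_succ]
      congr 1
      have h0 : (n : ℚ) + 1 ≠ 0 := by positivity
      field_simp
    rw [nsmul_eq_mul]
    linear_combination t * lrminSum t (Finset.Icc 1 (n - k)) * lrminSum 1 (Finset.Icc 1 k) * hc
  · simp

variable (A) in
/-- The part of odd index of the equation `J' = J * evenEGF` for `J = lrminEGF 1`: multiplication by
the even series `evenEGF` preserves parity, and differentiation changes it. -/
theorem derivative_evenEGF : d⁄dX A (evenEGF A) = oddEGF A * evenEGF A := by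
  ext n
  have h := congrArg (coeff n) (derivative_lrminEGF (1 : A))
  rw [map_one, one_mul, coeff_derivative, coeff_mul] at h
  rw [coeff_derivative, evenEGF, coeff_mk, ite_mul, zero_mul, h, ← evenEGF, coeff_mul,
    Finset.ite_sum_zero]
  refine Finset.sum_congr rfl fun p hp => ?_
  have hp := Finset.HasAntidiagonal.mem_antidiagonal.1 hp
  by_cases he : Even p.2
  · have hiff : Even (n + 1) ↔ Odd p.1 := by rw [← hp]; grind
    simp only [hiff, oddEGF, coeff_mk, ite_mul, zero_mul]
  · simp [evenEGF, he]

variable (A) in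
/-- The part of even index of the equation `J' = J * evenEGF` for `J = lrminEGF 1`. -/
theorem derivative_oddEGF : d⁄dX A (oddEGF A) = evenEGF A * evenEGF A := by
  ext n
  have h := congrArg (coeff n) (derivative_lrminEGF (1 : A))
  rw [map_one, one_mul, coeff_derivative, coeff_mul] at h
  rw [coeff_derivative, oddEGF, coeff_mk, ite_mul, zero_mul, h, coeff_mul, Finset.ite_sum_zero]
  refine Finset.sum_congr rfl fun p hp => ?_
  have hp := Finset.HasAntidiagonal.mem_antidiagonal.1 hp
  by_cases he : Even p.2
  · have hiff : Odd (n + 1) ↔ Even p.1 := by rw [← hp]; grind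
    simp only [hiff, evenEGF, coeff_mk, ite_mul, zero_mul]
  · simp [evenEGF, he]

theorem evenEGF_eq_map_sec [IsAddTorsionFree A] (f : ℚ →+* A) : evenEGF A = map f sec := by
  refine eq_of_derivative_eq_mul_of_derivative_eq_mul_self (derivative_evenEGF A)
    (derivative_oddEGF A) (o' := map f tan) ?_ ?_ ?_ ?_
  · rw [derivative_map, derivative_sec, map_mul]
  · rw [derivative_map, derivative_tan, map_mul]
  · rw [← coeff_zero_eq_constantCoeff_apply, ← coeff_zero_eq_constantCoeff_apply, evenEGF,
      coeff_mk, if_pos (by simp), coeff_map, coeff_zero_eq_constantCoeff_apply,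
      coeff_zero_eq_constantCoeff_apply, constantCoeff_lrminEGF, constantCoeff_sec, map_one]
  · rw [← coeff_zero_eq_constantCoeff_apply, ← coeff_zero_eq_constantCoeff_apply, oddEGF,
      coeff_mk, if_neg (by simp), coeff_map, coeff_zero_eq_constantCoeff_apply,
      constantCoeff_tan, map_zero]

end EGF

theorem constantCoeff_map_sec_add_tan {A : Type*} [CommRing A] (f : ℚ →+* A) :
    constantCoeff (map f (sec + tan)) = 1 := by
  rw [← coeff_zero_eq_constantCoeff_apply, coeff_map, coeff_zero_eq_constantCoeff_apply, map_add,
    constantCoeff_sec, constantCoeff_tan, add_zero, map_one]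

/-- `(log (sec + tan))' = sec`, because `(sec + tan)' = (sec + tan) sec`. -/
theorem derivative_logOf_map_sec_add_tan {A : Type*} [CommRing A] [IsDomain A] [Algebra ℚ A]
    (f : ℚ →+* A) : d⁄dX A (logOf (map f (sec + tan))) = map f sec := by
  have h1 := constantCoeff_map_sec_add_tan f
  have h0 : map f (sec + tan) ≠ 0 := fun h => by
    rw [h, map_zero] at h1
    exact zero_ne_one h1
  refine mul_right_cancel₀ h0 ?_
  rw [derivative_logOf_mul h1, derivative_map, map_add, derivative_sec, derivative_tan, ← map_mul]
  congr 1
  ring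

theorem lrminEGF_eq_formalPow {A : Type*} [CommRing A] [IsDomain A] [Algebra ℚ A]
    [IsAddTorsionFree A] (f : ℚ →+* A) (t : A) :
    lrminEGF t = formalPow (map f (sec + tan)) t := by
  have h1 := constantCoeff_map_sec_add_tan f
  refine eq_of_derivative_eq_mul (derivative_lrminEGF t) ?_ ?_
  · rw [derivative_formalPow h1, derivative_logOf_map_sec_add_tan, evenEGF_eq_map_sec f]
  · rw [constantCoeff_lrminEGF, constantCoeff_formalPow h1]

end JacobiPerm

theorem theorem2p6 :
    JacobiPerm.lrminGenFun =
      JacobiPerm.formalPow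
        (PowerSeries.map (Polynomial.C : ℚ →+* Polynomial ℚ) (JacobiPerm.sec + JacobiPerm.tan))
        (Polynomial.X : Polynomial ℚ) := by
  -- `lrminGenFun` is `lrminEGF Polynomial.X` by definition: `algebraMap ℚ ℚ[X]` unfolds to
  -- `Polynomial.C`.
  exact JacobiPerm.lrminEGF_eq_formalPow Polynomial.C Polynomial.X
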